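/- An $\mathrm{STS}(v)$ (Steiner triple system of order $v$, $v>3$) is a pair $(V,\mathcal B)$, where $V$ is a set of $v$ points and $\mathcal B$ is a set of $3$-element subsets of $V$ (blocks) such that every $2$-element subset of $V$ is contained in exactly one block. Its $0$-block intersection graph $G_0 = 0\text{-}\mathrm{BIG}(\mathrm{STS}(v))$ has the blocks as vertices, two distinct blocks being adjacent if and only if they are disjoint; it is a regular graph. Let $G$ be an $r$-regular graph. A vertex $x$ is rainbow with respect to a proper $(r+1)$-coloring of $G$ if all $r+1$ colors appear in the closed neighborhood $N[x]=N(x)\cup\{x\}$. The graph $G$ is silver if there are a maximum independent set $I$ of $G$ and a proper $(r+1)$-coloring of $G$ with respect to which every vertex of $I$ is rainbow; it is totally silver if there is a proper $(r+1)$-coloring of $G$ with respect to which every vertex of $G$ is rainbow. Theorem. Let $v$ be admissible (that is, an $\mathrm{STS}(v)$ exists). If $v>9$, then for every $\mathrm{STS}(v)$ the graph $G_0 = 0\text{-}\mathrm{BIG}(\mathrm{STS}(v))$ is not silver. If $v=7$ or $v=9$, then for every $\mathrm{STS}(v)$ the graph $G_0$ is totally silver. -/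

import Mathlib

/-- `𝓑` is the set of blocks of a Steiner 2-design `S(2, k, v)`, i.e. a `2-(v, k, 1)` design with
`2 < k < v`, on the point set `V`. As `λ = 1` and `2 < k`, no block can be repeated, so the
collection of blocks is a set. -/
structure IsSteinerTwoDesign {V : Type*} [Fintype V] (k v : ℕ) (𝓑 : Finset (Finset V)) :
    Prop where
  two_lt : 2 < k
  lt_points : k < v
  card_points : Fintype.card V = v
  card_block : ∀ B ∈ 𝓑, B.card = k
  existsUnique_block : ∀ x y : V, x ≠ y → ∃! B, B ∈ 𝓑 ∧ x ∈ B ∧ y ∈ B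

/-- A Steiner triple system `STS(v)`. -/
abbrev IsSTS {V : Type*} [Fintype V] (v : ℕ) (𝓑 : Finset (Finset V)) : Prop :=
  IsSteinerTwoDesign 3 v 𝓑

/-- The `i`-block intersection graph `i`-BIG: vertices are the blocks, and two (distinct) blocks
are adjacent iff they meet in exactly `i` points. -/
def blockIntersectionGraph {V : Type*} [DecidableEq V] (𝓑 : Finset (Finset V)) (i : ℕ) :
    SimpleGraph 𝓑 where
  Adj B C := B ≠ C ∧ ((B : Finset V) ∩ (C : Finset V)).card = i
  symm := ⟨fun B C h => ⟨h.1.symm, by rw [Finset.inter_comm]; exact h.2⟩⟩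
  loopless := ⟨fun _ h => h.1 rfl⟩

instance {V : Type*} [DecidableEq V] (𝓑 : Finset (Finset V)) (i : ℕ) :
    DecidableRel (blockIntersectionGraph 𝓑 i).Adj := fun B C =>
  inferInstanceAs (Decidable (B ≠ C ∧ ((B : Finset V) ∩ (C : Finset V)).card = i))

/-- A vertex `x` is rainbow for a proper colouring `c` if every colour appears in the closed
neighbourhood of `x`. -/
def IsRainbow {W α : Type*} {G : SimpleGraph W} (c : G.Coloring α) (x : W) : Prop :=
  ∀ a : α, ∃ y : W, (y = x ∨ G.Adj x y) ∧ c y = a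

/-- `G` is `r`-regular for some `r`, and has a proper `(r + 1)`-colouring for which all vertices
of some maximum independent set `I` are rainbow. -/
def IsSilver {W : Type*} [Fintype W] (G : SimpleGraph W) [DecidableRel G.Adj] : Prop :=
  ∃ r : ℕ, G.IsRegularOfDegree r ∧
    ∃ I : Finset W, G.IsMaximumIndepSet I ∧
      ∃ c : G.Coloring (Fin (r + 1)), ∀ x ∈ I, IsRainbow c x

/-- `G` is `r`-regular for some `r`, and has a proper `(r + 1)`-colouring for which all vertices
are rainbow. -/
def IsTotallySilver {W : Type*} [Fintype W] (G : SimpleGraph W) [DecidableRel G.Adj] : Prop :=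
  ∃ r : ℕ, G.IsRegularOfDegree r ∧ ∃ c : G.Coloring (Fin (r + 1)), ∀ x : W, IsRainbow c x

section SteinerTripleSystem

open Finset

variable {V : Type*} [Fintype V] {v : ℕ} {𝓑 : Finset (Finset V)}

/-! An independent set of $G_0$ is a family of pairwise intersecting blocks. Let $\rho=(v-1)/2$, the
number of blocks through a point. For $v\ge 13$ a maximum such family $I$ has $\rho$ members: it is
a pencil, or a Fano plane inside an STS(15) (`IsSTS.maximum_intersecting`). Any other block meets
exactly three members of $I$. If $I$ is rainbow, then, as $r+1>\rho$, some colour class $A$ misses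
$I$. Each member of $I$ has one neighbour in $A$ and each member of $A$ has $\rho-3$ in $I$, so
$|A|(\rho-3)=\rho$ (`card_colorClass_mul`). Since $\rho\ge 6$, this forces $|A|=2$, $\rho=6$, and
$I$ is a pencil. The two blocks of $A$ share a point, and the block of $I$ through it has no
neighbour in $A$. For $v\le 9$, $G_0$ is a disjoint union of complete graphs $K_{r+1}$, each
coloured bijectively. -/

/-- Two blocks sharing two points coincide. -/
lemma IsSteinerTwoDesign.eq_of_mem {k : ℕ} (h : IsSteinerTwoDesign k v 𝓑) {B C : Finset V}
    (hB : B ∈ 𝓑) (hC : C ∈ 𝓑) {x y : V} (hxy : x ≠ y) (hxB : x ∈ B) (hyB : y ∈ B)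
    (hxC : x ∈ C) (hyC : y ∈ C) : B = C :=
  (h.existsUnique_block x y hxy).unique ⟨hB, hxB, hyB⟩ ⟨hC, hxC, hyC⟩

/-! ### Counting blocks by their points -/

variable [DecidableEq V]

/-- The blocks of `F` through a point `x` cover `1 + 2 d` points, where `d` is their number. -/
lemma IsSTS.card_biUnion_erase (h : IsSTS v 𝓑) {F : Finset (Finset V)} (hF : F ⊆ 𝓑) (x : V) :
    #({C ∈ F | x ∈ C}.biUnion fun C => C.erase x) = 2 * #{C ∈ F | x ∈ C} := by
  rw [card_biUnion]
  · rw [sum_const_nat (m := 2), mul_comm]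
    intro C hC
    rw [mem_filter] at hC
    rw [card_erase_of_mem hC.2, h.card_block C (hF hC.1)]
  · intro C hC D hD hCD
    rw [mem_coe, mem_filter] at hC hD
    refine disjoint_left.2 fun y hyC hyD => hCD ?_
    rw [mem_erase] at hyC hyD
    exact h.eq_of_mem (hF hC.1) (hF hD.1) hyC.1 hyC.2 hC.2 hyD.2 hD.2

/-- The replication number of a Steiner triple system. -/
lemma IsSTS.two_mul_card_pencil (h : IsSTS v 𝓑) (p : V) : 2 * #{C ∈ 𝓑 | p ∈ C} + 1 = v := by
  have hcover : ({C ∈ 𝓑 | p ∈ C}.biUnion fun C => C.erase p) = univ.erase p := by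
    ext y
    simp only [mem_biUnion, mem_filter, mem_erase, mem_univ, and_true]
    constructor
    · rintro ⟨C, -, hy, -⟩
      exact hy
    · intro hy
      obtain ⟨C, ⟨hC, hpC, hyC⟩, -⟩ := h.existsUnique_block p y (Ne.symm hy)
      exact ⟨C, ⟨hC, hpC⟩, hy, hyC⟩
  have hcard := h.card_biUnion_erase (Subset.refl 𝓑) p
  rw [hcover, card_erase_of_mem (mem_univ p), card_univ, h.card_points] at hcard
  have := h.lt_points
  omega

lemma IsSTS.card_pencil (h : IsSTS v 𝓑) (p : V) : #{C ∈ 𝓑 | p ∈ C} = (v - 1) / 2 := by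
  have := h.two_mul_card_pencil p
  omega

/-- The number of blocks of a Steiner triple system. -/
lemma IsSTS.three_mul_card (h : IsSTS v 𝓑) : 3 * #𝓑 = v * ((v - 1) / 2) := by
  have hsum := sum_card (B := 𝓑) h.card_pencil
  rw [sum_const_nat h.card_block, h.card_points] at hsum
  omega

/-- The blocks of `F` meeting a block `B ∉ F` are counted by the points of `B`. -/
lemma IsSTS.card_meeting (h : IsSTS v 𝓑) {F : Finset (Finset V)} (hF : F ⊆ 𝓑) {B : Finset V}
    (hB : B ∈ 𝓑) (hBF : B ∉ F) :
    #{C ∈ F | ¬ Disjoint B C} = ∑ x ∈ B, #{C ∈ F | x ∈ C} := by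
  rw [← card_biUnion]
  · congr 1
    ext C
    simp only [mem_filter, mem_biUnion, not_disjoint_iff]
    tauto
  -- A member of `F` through two points of `B` would be `B` itself.
  · intro x hx y hy hxy
    refine disjoint_left.2 fun C hxC hyC => hBF ?_
    rw [mem_filter] at hxC hyC
    rw [h.eq_of_mem hB (hF hxC.1) hxy hx hy hxC.2 hyC.2]
    exact hxC.1

lemma IsSTS.card_pencil_inter_le_one (h : IsSTS v 𝓑) {F : Finset (Finset V)} (hF : F ⊆ 𝓑)
    {x y : V} (hxy : x ≠ y) : #{D ∈ {D ∈ F | x ∈ D} | y ∈ D} ≤ 1 := by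
  refine card_le_one.2 fun C hC D hD => ?_
  simp only [mem_filter] at hC hD
  exact h.eq_of_mem (hF hC.1.1) (hF hD.1.1) hxy hC.1.2 hC.2 hD.1.2 hD.2

/-- A block misses exactly `#𝓑 - 1 - 3 (ρ - 1)` others, `ρ` being the replication number. -/
lemma IsSTS.card_disjoint_add (h : IsSTS v 𝓑) {B : Finset V} (hB : B ∈ 𝓑) :
    #{C ∈ 𝓑 | Disjoint B C} + 3 * ((v - 1) / 2 - 1) + 1 = #𝓑 := by
  have hne : B.Nonempty := by
    rw [← card_pos, h.card_block B hB]
    norm_num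
  have hmeet := h.card_meeting (erase_subset B 𝓑) hB (notMem_erase B 𝓑)
  have hdeg : ∀ x ∈ B, #{C ∈ 𝓑.erase B | x ∈ C} = (v - 1) / 2 - 1 := by
    intro x hx
    rw [filter_erase, card_erase_of_mem (mem_filter.2 ⟨hB, hx⟩), h.card_pencil]
  rw [sum_const_nat hdeg, h.card_block B hB] at hmeet
  have hsplit := card_filter_add_card_filter_not (s := 𝓑.erase B) (fun C => Disjoint B C)
  have herase : {C ∈ 𝓑.erase B | Disjoint B C} = {C ∈ 𝓑 | Disjoint B C} := by
    rw [filter_erase, erase_eq_of_notMem]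
    simp [hne.ne_empty]
  rw [herase, hmeet, card_erase_of_mem hB] at hsplit
  have := card_pos.2 ⟨B, hB⟩
  omega

/-- A block not through `p` meets exactly three blocks through `p`. -/
lemma IsSTS.card_pencil_meeting (h : IsSTS v 𝓑) {B : Finset V} (hB : B ∈ 𝓑) {p : V}
    (hp : p ∉ B) : #{C ∈ {C ∈ 𝓑 | p ∈ C} | ¬ Disjoint B C} = 3 := by
  rw [h.card_meeting (filter_subset _ _) hB (fun hBp => hp (mem_filter.1 hBp).2),
    sum_const_nat (m := 1), h.card_block B hB]
  intro x hx
  have hpx : p ≠ x := fun e => hp (e ▸ hx)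
  refine le_antisymm (h.card_pencil_inter_le_one (Subset.refl _) hpx) (card_pos.2 ?_)
  obtain ⟨C, ⟨hC, hpC, hxC⟩, -⟩ := h.existsUnique_block p x hpx
  exact ⟨C, by simp [hC, hpC, hxC]⟩

/-! ### Intersecting families without a common point -/

/-- Six or more pairwise intersecting blocks without a common point live on seven points. -/
lemma IsSTS.exists_card_eq_seven (h : IsSTS v 𝓑) {F : Finset (Finset V)} (hF : F ⊆ 𝓑)
    (hmeet : ∀ B ∈ F, ∀ C ∈ F, ¬ Disjoint B C) (hcard : 6 ≤ #F)
    (hstar : ∀ p, ∃ B ∈ F, p ∉ B) :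
    ∃ S : Finset V, #S = 7 ∧ ∀ B ∈ F, B ⊆ S := by
  obtain ⟨B, hB⟩ : F.Nonempty := card_pos.1 (by omega)
  -- At least five other blocks meet `B` in its three points, so some point lies on two of them.
  obtain ⟨x, hx, hdeg⟩ : ∃ x ∈ B, 2 ≤ #{C ∈ F.erase B | x ∈ C} := by
    by_contra! hlt
    have hsum := h.card_meeting ((erase_subset B F).trans hF) (hF hB) (notMem_erase B F)
    rw [filter_true_of_mem fun C hC => hmeet B hB C (mem_of_mem_erase hC),
      card_erase_of_mem hB] at hsum
    have hle := sum_le_card_nsmul B (fun x => #{C ∈ F.erase B | x ∈ C}) 1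
      (fun x hx => Nat.le_of_lt_succ (hlt x hx))
    rw [h.card_block B (hF hB), smul_eq_mul] at hle
    omega
  rw [filter_erase, card_erase_of_mem (mem_filter.2 ⟨hB, hx⟩)] at hdeg
  set T := {C ∈ F | x ∈ C} with hT
  have hTF : T ⊆ F := filter_subset _ _
  have hcount : ∀ C ∈ F, x ∉ C → #T = ∑ y ∈ C, #{D ∈ T | y ∈ D} := by
    intro C hC hxC
    rw [← h.card_meeting (hTF.trans hF) (hF hC) (fun hCT => hxC (mem_filter.1 hCT).2),
      filter_true_of_mem fun D hD => hmeet C hC D (hTF hD)]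
  have hle : ∀ C : Finset V, x ∉ C → ∀ y ∈ C, #{D ∈ T | y ∈ D} ≤ 1 := fun C hxC y hy =>
    h.card_pencil_inter_le_one hF fun e => hxC (e ▸ hy)
  -- A block avoiding `x` meets the members of `T` in distinct points, so there are at most three of
  -- them.
  have hTcard : #T = 3 := by
    obtain ⟨C, hC, hxC⟩ := hstar x
    have hsum := sum_le_card_nsmul C (fun y => #{D ∈ T | y ∈ D}) 1 (hle C hxC)
    rw [← hcount C hC hxC, h.card_block C (hF hC), smul_eq_mul] at hsum
    omega
  refine ⟨insert x (T.biUnion fun C => C.erase x), ?_, ?_⟩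
  · rw [card_insert_of_notMem (by simp), h.card_biUnion_erase hF x, hTcard]
  · intro C hC y hy
    rw [mem_insert, mem_biUnion]
    by_cases hyx : y = x
    · exact Or.inl hyx
    right
    by_cases hxC : x ∈ C
    · exact ⟨C, mem_filter.2 ⟨hC, hxC⟩, mem_erase.2 ⟨hyx, hy⟩⟩
    have hpos : 0 < #{D ∈ T | y ∈ D} := by
      by_contra! hzero
      have hlt : ∑ y ∈ C, #{D ∈ T | y ∈ D} < ∑ y ∈ C, 1 :=
        sum_lt_sum (hle C hxC) ⟨y, hy, by omega⟩
      rw [← hcount C hC hxC, hTcard, sum_const, h.card_block C (hF hC)] at hlt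
      simp at hlt
    obtain ⟨D, hD⟩ := card_pos.1 hpos
    rw [mem_filter] at hD
    exact ⟨D, hD.1, mem_erase.2 ⟨hyx, hD.2⟩⟩

/-- The pairs of points of `S` that lie in no block of `F`. -/
def uncoveredPairs (F : Finset (Finset V)) (S : Finset V) : Finset (Finset V) :=
  S.powersetCard 2 \ F.biUnion (powersetCard 2)

lemma pair_mem_uncoveredPairs {α : Type*} [DecidableEq α] {F : Finset (Finset α)}
    {S : Finset α} {x y : α} (hxy : x ≠ y)
    (hx : x ∈ S) (hy : y ∈ S) (hF : ∀ C ∈ F, x ∈ C → y ∉ C) :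
    {x, y} ∈ uncoveredPairs F S := by
  simp only [uncoveredPairs, mem_sdiff, mem_powersetCard, mem_biUnion, card_pair hxy,
    insert_subset_iff, singleton_subset_iff, and_true, not_exists, not_and]
  exact ⟨⟨hx, hy⟩, fun C hC hxC => hF C hC hxC⟩

/-- Distinct blocks share no pair, so each block of `F` uses up three of the 21 pairs of `S`. -/
lemma IsSTS.card_uncoveredPairs (h : IsSTS v 𝓑) {F : Finset (Finset V)} (hF : F ⊆ 𝓑)
    {S : Finset V} (hS : #S = 7) (hFS : ∀ B ∈ F, B ⊆ S) :
    #(uncoveredPairs F S) + 3 * #F = 21 := by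
  have hsub : F.biUnion (powersetCard 2) ⊆ S.powersetCard 2 :=
    biUnion_subset.2 fun B hB => powersetCard_mono (hFS B hB)
  have hcard : #(F.biUnion (powersetCard 2)) = 3 * #F := by
    rw [card_biUnion, sum_const_nat (m := 3), mul_comm]
    · intro B hB
      rw [card_powersetCard, h.card_block B (hF hB)]
      rfl
    · intro B hB C hC hBC
      refine disjoint_left.2 fun P hPB hPC => hBC ?_
      rw [mem_powersetCard] at hPB hPC
      obtain ⟨x, y, hxy, rfl⟩ := card_eq_two.1 hPB.2
      exact h.eq_of_mem (hF hB) (hF hC) hxy (hPB.1 (by simp)) (hPB.1 (by simp))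
        (hPC.1 (by simp)) (hPC.1 (by simp))
  have hsd := card_sdiff_add_card_eq_card hsub
  rw [hcard, card_powersetCard, hS] at hsd
  exact hsd

/-- If the replication number is six, then each point outside a seven-set `S` spans a block with
two points of `S`. Such pairs are too few when `S` carries six or more blocks. -/
lemma IsSTS.ne_thirteen (h : IsSTS v 𝓑) {F : Finset (Finset V)} (hF : F ⊆ 𝓑)
    {S : Finset V} (hS : #S = 7) (hFS : ∀ B ∈ F, B ⊆ S) (hcard : 6 ≤ #F) : v ≠ 13 := by
  intro hv
  have hex : ∀ z ∈ Sᶜ, ∃ P ∈ uncoveredPairs F S, ∃ B ∈ 𝓑, P ⊆ B ∧ z ∈ B := by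
    intro z hz
    rw [mem_compl] at hz
    have hne : ∀ x ∈ S, z ≠ x := fun x hx e => hz (e ▸ hx)
    have hblock : ∀ x ∈ S, ∃ B ∈ {C ∈ 𝓑 | z ∈ C}, x ∈ B := by
      intro x hx
      obtain ⟨B, ⟨hB, hzB, hxB⟩, -⟩ := h.existsUnique_block z x (hne x hx)
      exact ⟨B, mem_filter.2 ⟨hB, hzB⟩, hxB⟩
    choose! f hf hxf using hblock
    -- Seven points of `S`, but only six blocks through `z`.
    obtain ⟨x, hx, y, hy, hxy, hfxy⟩ := exists_ne_map_eq_of_card_lt_of_maps_to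
      (by rw [h.card_pencil z, hS, hv]; norm_num) hf
    have hfx := mem_filter.1 (hf x hx)
    have hyfx : y ∈ f x := hfxy ▸ hxf y hy
    refine ⟨{x, y}, pair_mem_uncoveredPairs hxy hx hy fun C hC hxC hyC => hz ?_, f x, hfx.1,
      by simp [insert_subset_iff, hxf x hx, hyfx], hfx.2⟩
    rw [h.eq_of_mem hfx.1 (hF hC) hxy (hxf x hx) hyfx hxC hyC] at hfx
    exact hFS C hC hfx.2
  choose! P hP B hB hPB hzB using hex
  have hinj : Set.InjOn P (Sᶜ : Finset V) := by
    intro z hz w hw hzw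
    have hPz := hP z hz
    rw [uncoveredPairs, mem_sdiff, mem_powersetCard] at hPz
    have hzP : z ∉ P z := fun hzP => mem_compl.1 hz (hPz.1.1 hzP)
    have hwP : w ∉ P z := fun hwP => mem_compl.1 hw (hPz.1.1 hwP)
    obtain ⟨x, y, hxy, hxyP⟩ := card_eq_two.1 hPz.1.2
    have hxP : x ∈ P z := by simp [hxyP]
    have hyP : y ∈ P z := by simp [hxyP]
    have hBB : B w = B z := h.eq_of_mem (hB w hw) (hB z hz) hxy (hPB w hw (hzw ▸ hxP))
      (hPB w hw (hzw ▸ hyP)) (hPB z hz hxP) (hPB z hz hyP)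
    have hcardB : #(insert z (P z)) = 3 := by rw [card_insert_of_notMem hzP, hPz.1.2]
    have hins : insert z (P z) = B z := eq_of_subset_of_card_le
      (insert_subset (hzB z hz) (hPB z hz)) (by rw [hcardB, h.card_block _ (hB z hz)])
    have hwB := hzB w hw
    rw [hBB, ← hins, mem_insert] at hwB
    exact (hwB.resolve_right hwP).symm
  -- Six outside points would need six uncovered pairs; at most $21-18=3$ exist.
  have hle := card_le_card_of_injOn P hP hinj
  have hU := h.card_uncoveredPairs hF hS hFS
  rw [card_compl, h.card_points, hS, hv] at hle
  omega

/-- In an `STS(15)`, every block outside a Fano subplane meets exactly three of its lines. -/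
lemma IsSTS.card_fano_meeting (h : IsSTS v 𝓑) {F : Finset (Finset V)} (hF : F ⊆ 𝓑)
    {S : Finset V} (hS : #S = 7) (hFS : ∀ B ∈ F, B ⊆ S) (hcard : #F = 7) (hv : v = 15)
    {B : Finset V} (hB : B ∈ 𝓑) (hBF : B ∉ F) : #{C ∈ F | ¬ Disjoint B C} = 3 := by
  have hcov : ∀ x ∈ S, ∀ y ∈ S, x ≠ y → ∃ C ∈ F, x ∈ C ∧ y ∈ C := by
    intro x hx y hy hxy
    by_contra! hno
    have hpos := card_pos.2 ⟨_, pair_mem_uncoveredPairs hxy hx hy hno⟩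
    have hU := h.card_uncoveredPairs hF hS hFS
    omega
  have hone : ∀ D ∈ 𝓑, D ∉ F → ∀ x ∈ S, ∀ y ∈ S, x ∈ D → y ∈ D → x = y := by
    intro D hD hDF x hx y hy hxD hyD
    by_contra hxy
    obtain ⟨C, hC, hxC, hyC⟩ := hcov x hx y hy hxy
    exact hDF (h.eq_of_mem hD (hF hC) hxy hxD hyD hxC hyC ▸ hC)
  obtain ⟨z, hzB, hzS⟩ : ∃ z ∈ B, z ∉ S := by
    by_contra! hsub
    have hle : #B ≤ 1 := card_le_one.2 fun x hx y hy =>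
      hone B hB hBF x (hsub x hx) y (hsub y hy) hx hy
    rw [h.card_block B hB] at hle
    omega
  have hne : ∀ x ∈ S, z ≠ x := fun x hx e => hzS (e ▸ hx)
  -- Joining `z` to the seven points of `S` gives seven distinct blocks, hence all blocks through
  -- `z`, including `B`.
  obtain ⟨x, hxS, hxB⟩ : ∃ x ∈ S, x ∈ B := by
    have hblock : ∀ x ∈ S, ∃ D ∈ {C ∈ 𝓑 | z ∈ C}, x ∈ D := by
      intro x hx
      obtain ⟨D, ⟨hD, hzD, hxD⟩, -⟩ := h.existsUnique_block z x (hne x hx)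
      exact ⟨D, mem_filter.2 ⟨hD, hzD⟩, hxD⟩
    choose! f hf hxf using hblock
    have hinj : Set.InjOn f S := by
      intro x hx y hy hxy
      have hfx := mem_filter.1 (hf x hx)
      exact hone (f x) hfx.1 (fun hfF => hzS (hFS _ hfF hfx.2)) x hx y hy (hxf x hx)
        (hxy ▸ hxf y hy)
    obtain ⟨x, hx, hfx⟩ := surjOn_of_injOn_of_card_le f hf hinj
      (by rw [h.card_pencil z, hS, hv]) (mem_coe.2 (mem_filter.2 ⟨hB, hzB⟩))
    exact ⟨x, hx, hfx ▸ hxf x hx⟩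
  rw [h.card_meeting hF hB hBF, sum_eq_single_of_mem x hxB]
  · have hdeg := h.card_biUnion_erase hF x
    have hcover : ({C ∈ F | x ∈ C}.biUnion fun C => C.erase x) = S.erase x := by
      ext y
      simp only [mem_biUnion, mem_filter, mem_erase]
      constructor
      · rintro ⟨C, ⟨hC, -⟩, hyx, hyC⟩
        exact ⟨hyx, hFS C hC hyC⟩
      · rintro ⟨hyx, hyS⟩
        obtain ⟨C, hC, hxC, hyC⟩ := hcov x hxS y hyS (Ne.symm hyx)
        exact ⟨C, ⟨hC, hxC⟩, hyx, hyC⟩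
    rw [hcover, card_erase_of_mem hxS, hS] at hdeg
    omega
  · intro y hyB hyx
    rw [card_eq_zero, filter_eq_empty_iff]
    exact fun C hC hyC => hyx (hone B hB hBF y (hFS C hC hyC) x hxS hyB hxB)

/-! ### Translation to the graph, and rainbow vertices -/

lemma IsSTS.adj_iff_disjoint (h : IsSTS v 𝓑) (B C : 𝓑) :
    (blockIntersectionGraph 𝓑 0).Adj B C ↔ Disjoint (B : Finset V) C := by
  change B ≠ C ∧ #((B : Finset V) ∩ C) = 0 ↔ _
  rw [card_eq_zero, ← disjoint_iff_inter_eq_empty, and_iff_right_iff_imp]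
  rintro hd rfl
  have := h.card_block B B.2
  rw [disjoint_self.1 hd] at this
  simp at this

lemma card_filter_subtype {α : Type*} [DecidableEq α] {s t : Finset α} (hts : t ⊆ s)
    (p : α → Prop) [DecidablePred p] (T : Finset s) (hT : ∀ x : s, x ∈ T ↔ (x : α) ∈ t) :
    #(T.filter fun x : s => p x) = #(t.filter p) := by
  rw [← card_map (Function.Embedding.subtype _)]
  congr 1
  ext x
  simp only [mem_map, mem_filter, Function.Embedding.subtype_apply, Subtype.exists, hT]
  constructor
  · rintro ⟨y, -, hy, rfl⟩
    exact hy
  · intro hx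
    exact ⟨x, hts hx.1, hx, rfl⟩

lemma IsSTS.degree_add (h : IsSTS v 𝓑) (B : 𝓑) :
    (blockIntersectionGraph 𝓑 0).degree B + 3 * ((v - 1) / 2 - 1) + 1 = #𝓑 := by
  rw [← h.card_disjoint_add B.2, ← SimpleGraph.card_neighborFinset_eq_degree,
    ← card_filter_subtype (Subset.refl 𝓑) _ univ (by simp)]
  congr 2
  refine congrArg card (Finset.ext fun C => ?_)
  simp [h.adj_iff_disjoint]

/-- The closed neighbourhood of a rainbow vertex contains each colour exactly once. -/
lemma IsRainbow.existsUnique {W : Type*} [Fintype W] [DecidableEq W] {G : SimpleGraph W}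
    [DecidableRel G.Adj] {r : ℕ} (hr : G.IsRegularOfDegree r) {c : G.Coloring (Fin (r + 1))}
    {x : W} (hx : IsRainbow c x) (a : Fin (r + 1)) :
    ∃! y, (y = x ∨ G.Adj x y) ∧ c y = a := by
  have hmem : ∀ y, y ∈ insert x (G.neighborFinset x) ↔ y = x ∨ G.Adj x y := by simp
  have hsurj : Set.SurjOn c (insert x (G.neighborFinset x) : Finset W)
      (univ : Finset (Fin (r + 1))) := by
    intro b _
    obtain ⟨y, hy, hyb⟩ := hx b
    exact ⟨y, (hmem y).2 hy, hyb⟩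
  have hinj := injOn_of_surjOn_of_card_le c (fun _ _ => mem_univ _) hsurj (by
    rw [card_insert_of_notMem (by simp), G.card_neighborFinset_eq_degree, hr x]
    simp)
  obtain ⟨y, hy, hya⟩ := hx a
  exact ⟨y, ⟨hy, hya⟩, fun z hz =>
    hinj ((hmem z).2 hz.1) ((hmem y).2 hy) (hz.2.trans hya.symm)⟩

/-- Double counting of the edges between an independent rainbow set and a colour class. -/
lemma card_colorClass_mul {W : Type*} [Fintype W] [DecidableEq W] {G : SimpleGraph W}
    [DecidableRel G.Adj] {r : ℕ} (hr : G.IsRegularOfDegree r) {c : G.Coloring (Fin (r + 1))}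
    {I : Finset W} (hI : ∀ x ∈ I, IsRainbow c x) {a : Fin (r + 1)} (ha : ∀ x ∈ I, c x ≠ a)
    {d : ℕ} (hd : ∀ y ∉ I, #{x ∈ I | G.Adj x y} = d) :
    #{y | c y = a} * d = #I := by
  have hsum := sum_card_bipartiteAbove_eq_sum_card_bipartiteBelow (s := I) (t := {y | c y = a})
    G.Adj
  rw [sum_const_nat (m := 1), sum_const_nat (m := d), mul_one] at hsum
  · exact hsum.symm
  · intro y hy
    exact hd y fun hyI => ha y hyI (mem_filter.1 hy).2
  · intro x hx
    obtain ⟨y, ⟨hy, hya⟩, huniq⟩ := (hI x hx).existsUnique hr a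
    refine card_eq_one.2 ⟨y, ?_⟩
    ext z
    simp only [bipartiteAbove, mem_filter, mem_univ, true_and, mem_singleton]
    constructor
    · rintro ⟨hza, hxz⟩
      exact huniq z ⟨Or.inr hxz, hza⟩
    · rintro rfl
      exact ⟨hya, hy.resolve_left fun e => ha x hx (e ▸ hya)⟩

/-! ### Orders above nine -/

/-- A maximum intersecting family of blocks is a pencil, or has seven members with `v = 15`. In
both cases every other block meets exactly three members. -/
lemma IsSTS.maximum_intersecting (h : IsSTS v 𝓑) (hv : 13 ≤ v) {F : Finset (Finset V)}
    (hF : F ⊆ 𝓑) (hmeet : ∀ B ∈ F, ∀ C ∈ F, ¬ Disjoint B C) (hcard : (v - 1) / 2 ≤ #F) :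
    (∃ p, F = {C ∈ 𝓑 | p ∈ C}) ∨
      (#F = 7 ∧ v = 15 ∧ ∀ B ∈ 𝓑, B ∉ F → #{C ∈ F | ¬ Disjoint B C} = 3) := by
  by_cases hstar : ∀ p, ∃ B ∈ F, p ∉ B
  · right
    obtain ⟨S, hS, hFS⟩ := h.exists_card_eq_seven hF hmeet (by omega) hstar
    have hU := h.card_uncoveredPairs hF hS hFS
    have hne := h.ne_thirteen hF hS hFS (by omega)
    obtain ⟨z, -⟩ : S.Nonempty := card_pos.1 (by omega)
    have hodd := h.two_mul_card_pencil z
    -- The pair count gives `#F ≤ 7`, so `v ≤ 16`; parity and `v ≠ 13` leave 15.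
    have hv15 : v = 15 := by omega
    exact ⟨by omega, hv15, fun B hB hBF =>
      h.card_fano_meeting hF hS hFS (by omega) hv15 hB hBF⟩
  · left
    push Not at hstar
    obtain ⟨p, hp⟩ := hstar
    exact ⟨p, eq_of_subset_of_card_le (fun B hB => mem_filter.2 ⟨hF hB, hp B hB⟩)
      (by rw [h.card_pencil]; exact hcard)⟩

lemma IsSTS.thirteen_le (h : IsSTS v 𝓑) (hv : 9 < v) : 13 ≤ v := by
  obtain ⟨p⟩ : Nonempty V := Fintype.card_pos_iff.1 (by rw [h.card_points]; omega)
  have hodd := h.two_mul_card_pencil p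
  have hb := h.three_mul_card
  by_contra! hlt
  obtain rfl : v = 11 := by omega
  -- The block count would satisfy $3b=55$.
  omega

lemma IsSTS.not_isSilver (h : IsSTS v 𝓑) (hv : 9 < v) :
    ¬ IsSilver (blockIntersectionGraph 𝓑 0) := by
  rintro ⟨r, hr, I, hI, c, hc⟩
  have hv13 := h.thirteen_le hv
  obtain ⟨p⟩ : Nonempty V := Fintype.card_pos_iff.1 (by rw [h.card_points]; omega)
  have hodd := h.two_mul_card_pencil p
  have hmeetI : ∀ B ∈ I, ∀ C ∈ I, ¬ Disjoint (B : Finset V) C := by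
    intro B hB C hC hd
    have hadj := (h.adj_iff_disjoint B C).2 hd
    exact hI.isIndepSet hB hC hadj.ne hadj
  set F := I.map (Function.Embedding.subtype _) with hFdef
  have hmemF : ∀ B : 𝓑, B ∈ I ↔ (B : Finset V) ∈ F := by
    intro B
    simp [hFdef]
  have hFcard : #F = #I := card_map _
  have hF : F ⊆ 𝓑 := by
    intro B hB
    obtain ⟨C, -, rfl⟩ := mem_map.1 hB
    exact C.2
  have hmeet : ∀ B ∈ F, ∀ C ∈ F, ¬ Disjoint B C := fun B hB C hC =>
    hmeetI ⟨B, hF hB⟩ ((hmemF _).2 hB) ⟨C, hF hC⟩ ((hmemF _).2 hC)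
  have hle : (v - 1) / 2 ≤ #F := by
    have hind : (blockIntersectionGraph 𝓑 0).IsIndepSet ({C : 𝓑 | p ∈ C.1} : Finset 𝓑) := by
      intro B hB C hC _ hadj
      rw [h.adj_iff_disjoint] at hadj
      exact disjoint_left.1 hadj (mem_filter.1 hB).2 (mem_filter.1 hC).2
    have hmax := hI.maximum _ hind
    rwa [card_filter_subtype (Subset.refl 𝓑) (fun C => p ∈ C) univ (by simp),
      h.card_pencil, ← hFcard] at hmax
  have hmax := h.maximum_intersecting hv13 hF hmeet hle
  have hthree : ∀ B ∈ 𝓑, B ∉ F → #{C ∈ F | ¬ Disjoint B C} = 3 := by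
    obtain ⟨q, hq⟩ | ⟨-, -, hF3⟩ := hmax
    · intro B hB hBF
      rw [hq] at hBF ⊢
      exact h.card_pencil_meeting hB fun hqB => hBF (mem_filter.2 ⟨hB, hqB⟩)
    · exact hF3
  have hIcard : #I = (v - 1) / 2 := by
    obtain ⟨q, hq⟩ | ⟨h7, h15, -⟩ := hmax
    · rw [← hFcard, hq, h.card_pencil]
    · rw [← hFcard, h7, h15]
  have hd : ∀ y ∉ I, #{x ∈ I | (blockIntersectionGraph 𝓑 0).Adj x y} = #I - 3 := by
    intro y hy
    have hsplit := card_filter_add_card_filter_not (s := F) (fun C => Disjoint (y : Finset V) C)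
    rw [hthree y y.2 (fun hyF => hy ((hmemF y).2 hyF)),
      ← card_filter_subtype hF _ I hmemF, hFcard] at hsplit
    rw [← hsplit, Nat.add_sub_cancel]
    refine congrArg card (Finset.ext fun x => ?_)
    simp [h.adj_iff_disjoint, disjoint_comm]
  obtain ⟨a, ha⟩ : ∃ a, ∀ x ∈ I, c x ≠ a := by
    have hlt : #(I.image c) < Fintype.card (Fin (r + 1)) := by
      refine card_image_le.trans_lt ?_
      obtain ⟨B, -⟩ : I.Nonempty := card_pos.1 (by omega)
      have hdeg := h.degree_add B
      have hb := h.three_mul_card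
      rw [hr B] at hdeg
      obtain ⟨ρ, rfl⟩ : ∃ ρ, v = 2 * ρ + 1 := ⟨_, hodd.symm⟩
      have hρ : (2 * ρ + 1 - 1) / 2 = ρ := by omega
      rw [hρ] at hb hdeg hIcard
      -- Thus $3b\ge 13\rho$ and $r+1=b-3(\rho-1)>\rho$.
      have : 13 * ρ ≤ (2 * ρ + 1) * ρ := Nat.mul_le_mul_right _ hv13
      rw [Fintype.card_fin, hIcard]
      omega
    obtain ⟨a, ha⟩ := exists_mem_notMem_of_card_lt_card (s := I.image c) (t := univ) hlt
    exact ⟨a, fun x hx e => ha.2 (mem_image.2 ⟨x, hx, e⟩)⟩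
  have hmul := card_colorClass_mul hr hc ha hd
  have htwo : 2 ≤ #{y | c y = a} := by
    by_contra! hlt
    interval_cases #{y | c y = a} <;> omega
  obtain ⟨q, hq⟩ | ⟨h7, -, -⟩ := hmax
  · have hsix : #{y | c y = a} = 2 := by
      refine le_antisymm ?_ htwo
      by_contra! hgt
      have := Nat.mul_le_mul_right (#I - 3) hgt
      omega
    obtain ⟨B, C, hBC, hA⟩ := card_eq_two.1 hsix
    have hB : c B = a := by
      have : B ∈ ({y | c y = a} : Finset 𝓑) := hA ▸ mem_insert_self B {C}
      exact (mem_filter.1 this).2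
    have hC : c C = a := by
      have : C ∈ ({y | c y = a} : Finset 𝓑) := hA ▸ mem_insert_of_mem (mem_singleton_self C)
      exact (mem_filter.1 this).2
    have hBq : q ∉ (B : Finset V) := fun hqB =>
      ha B ((hmemF B).2 (hq ▸ mem_filter.2 ⟨B.2, hqB⟩)) hB
    obtain ⟨x, hxB, hxC⟩ := not_disjoint_iff.1 fun hdis =>
      c.valid ((h.adj_iff_disjoint B C).2 hdis) (hB.trans hC.symm)
    obtain ⟨D, ⟨hD, hqD, hxD⟩, -⟩ := h.existsUnique_block q x fun e => hBq (e ▸ hxB)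
    have hDI : (⟨D, hD⟩ : 𝓑) ∈ I := (hmemF _).2 (hq ▸ mem_filter.2 ⟨hD, hqD⟩)
    obtain ⟨y, hy, hya⟩ := hc _ hDI a
    have hyA : y ∈ ({B, C} : Finset 𝓑) := hA ▸ mem_filter.2 ⟨mem_univ y, hya⟩
    have hadj := hy.resolve_left fun e => ha _ hDI (e ▸ hya)
    rw [h.adj_iff_disjoint] at hadj
    rw [mem_insert, mem_singleton] at hyA
    obtain rfl | rfl := hyA
    · exact disjoint_left.1 hadj hxD hxB
    · exact disjoint_left.1 hadj hxD hxC
  · rw [← hFcard, h7] at hmul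
    omega

/-! ### Orders at most nine -/

/-- A regular disjoint union of complete graphs is totally silver. -/
lemma isTotallySilver_of_trans {W : Type*} [Fintype W] [DecidableEq W] {G : SimpleGraph W}
    [DecidableRel G.Adj] {r : ℕ} (hr : G.IsRegularOfDegree r)
    (htrans : ∀ x y z, G.Adj x y → G.Adj y z → x ≠ z → G.Adj x z) : IsTotallySilver G := by
  classical
  let s : Setoid W :=
    { r := fun x y => y = x ∨ G.Adj x y
      iseqv :=
        { refl := fun x => Or.inl rfl
          symm := by
            rintro x y (rfl | hxy)
            · exact Or.inl rfl
            · exact Or.inr hxy.symm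
          trans := by
            rintro x y z (rfl | hxy) (rfl | hyz)
            · exact Or.inl rfl
            · exact Or.inr hyz
            · exact Or.inr hxy
            · by_cases hxz : x = z
              · exact Or.inl hxz.symm
              · exact Or.inr (htrans x y z hxy hyz hxz) } }
  have hcard : ∀ q : Quotient s, Fintype.card {y : W // Quotient.mk s y = q} = r + 1 := by
    intro q
    induction q using Quotient.inductionOn with
    | h x =>
      rw [Fintype.card_subtype, ← hr x, ← G.card_neighborFinset_eq_degree,
        ← card_insert_of_notMem (G.notMem_neighborFinset_self x)]
      congr 1
      ext y
      simp only [mem_filter, mem_univ, true_and, mem_insert, SimpleGraph.mem_neighborFinset]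
      rw [eq_comm, Quotient.eq]
      rfl
  let e := fun q : Quotient s => Fintype.equivFinOfCardEq (hcard q)
  -- Compares colours of vertices whose classes are equal only propositionally.
  have he : ∀ q (y : {y : W // Quotient.mk s y = q}),
      e (Quotient.mk s y) ⟨y, rfl⟩ = e q y := by
    rintro _ ⟨y, rfl⟩
    rfl
  refine ⟨r, hr, SimpleGraph.Coloring.mk (fun y => e (Quotient.mk s y) ⟨y, rfl⟩) ?_, ?_⟩
  · intro x y hxy heq
    have hq : Quotient.mk s y = Quotient.mk s x := Quotient.sound (Or.inr hxy.symm)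
    have hy := he (Quotient.mk s x) ⟨y, hq⟩
    have hxy' := (e (Quotient.mk s x)).injective (heq.trans hy)
    exact hxy.ne (congrArg Subtype.val hxy')
  · intro x a
    refine ⟨((e (Quotient.mk s x)).symm a : {y : W // _}), ?_, ?_⟩
    · exact Quotient.exact ((e (Quotient.mk s x)).symm a).2.symm
    · exact (he _ _).trans ((e (Quotient.mk s x)).apply_symm_apply a)

/-- For `v ≤ 9` disjointness of distinct blocks is transitive. -/
lemma IsSTS.disjoint_trans (h : IsSTS v 𝓑) (hv : v ≤ 9) {B C D : Finset V} (hB : B ∈ 𝓑)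
    (hC : C ∈ 𝓑) (hD : D ∈ 𝓑) (hBC : Disjoint B C) (hCD : Disjoint C D) (hne : B ≠ D) :
    Disjoint B D := by
  refine disjoint_left.2 fun p hpB hpD => hne ?_
  have hmeet := h.card_pencil_meeting hC (disjoint_left.1 hBC hpB)
  have hsplit := card_filter_add_card_filter_not (s := {E ∈ 𝓑 | p ∈ E}) (fun E => Disjoint C E)
  rw [hmeet, h.card_pencil] at hsplit
  -- At most four blocks pass through `p`, and three of them meet `C`.
  have hle : #{E ∈ {E ∈ 𝓑 | p ∈ E} | Disjoint C E} ≤ 1 := by omega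
  exact card_le_one.1 hle B (by simp [hB, hpB, hBC.symm]) D (by simp [hD, hpD, hCD])

lemma IsSTS.isTotallySilver (h : IsSTS v 𝓑) (hv : v ≤ 9) :
    IsTotallySilver (blockIntersectionGraph 𝓑 0) := by
  refine isTotallySilver_of_trans (r := #𝓑 - 1 - 3 * ((v - 1) / 2 - 1)) ?_ ?_
  · intro B
    have := h.degree_add B
    omega
  · intro B C D hBC hCD hne
    rw [h.adj_iff_disjoint] at hBC hCD ⊢
    exact h.disjoint_trans hv B.2 C.2 D.2 hBC hCD fun e => hne (Subtype.ext e)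

end SteinerTripleSystem

theorem mainTheorem8 {V : Type*} [Fintype V] [DecidableEq V] (v : ℕ) (𝓑 : Finset (Finset V))
    (h𝓑 : IsSTS v 𝓑) :
    (9 < v → ¬ IsSilver (blockIntersectionGraph 𝓑 0)) ∧
      (v = 7 ∨ v = 9 → IsTotallySilver (blockIntersectionGraph 𝓑 0)) :=
  ⟨h𝓑.not_isSilver, fun hv => h𝓑.isTotallySilver (by omega)⟩
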